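/- A rational transducer over a finite alphabet $\Sigma$ is a finite automaton with one initial state, a set of accepting states, and finitely many transitions $(q,u,v,q')$ labelled by pairs of (possibly empty) words $u,v\in\Sigma^*$; it recognizes the relation of all pairs $(u_1\cdots u_n, v_1\cdots v_n)$ read along a run from the initial state to an accepting state. A rational Kripke model $\mathcal{M}=(S,R,V)$ consists of a regular language $S\subseteq\Sigma^*$ over a finite alphabet $\Sigma$, a relation $R\subseteq S\times S$ recognized by a rational transducer, and a valuation $V$ of finitely many propositional variables in regular subsets of $S$ and of finitely many nominals in single elements of $S$. It is presented by $\Sigma$, finite automata for $S$ and for the sets $V(p)$, a transducer for $R$, and the words denoted by the nominals. Consider the fixed sentence $\downarrow\! x.\langle R\rangle x$ of the hybrid tense language $\mathbf{H}_t(@,\downarrow)$, where $\downarrow\! x$ binds the state variable $x$ to the current state; thus $\mathcal{M},s\models\ \downarrow\! x.\langle R\rangle x$ if and only if $s\,R\,s$. **Proposition.** Model checking of $\downarrow\! x.\langle R\rangle x$ on a given input rational Kripke model is not decidable: there is no algorithm which, given a presentation of a rational Kripke model $\mathcal{M}$, decides whether $\downarrow\! x.\langle R\rangle x$ is true at some state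 of $\mathcal{M}$, that is, whether $s\,R\,s$ for some $s\in S$. -/

import Mathlib

/-! Hybrid tense logic with satisfaction operators and the binder `↓`. -/

/-- Formulae of the hybrid tense language with `@` and `↓`, over propositional variables `Φ`,
nominals `Θ` and state variables `X`. -/
inductive HybridFormula (Φ Θ X : Type) : Type
  | prop (p : Φ)
  | nom (i : Θ)
  | var (x : X)
  | neg (φ : HybridFormula Φ Θ X)
  | or (φ ψ : HybridFormula Φ Θ X)
  | dia (φ : HybridFormula Φ Θ X)
  | diaInv (φ : HybridFormula Φ Θ X)
  | atNom (i : Θ) (φ : HybridFormula Φ Θ X)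
  | atVar (x : X) (φ : HybridFormula Φ Θ X)
  | bind (x : X) (φ : HybridFormula Φ Θ X)

/-- A hybrid Kripke model `(S, R, V)`. Each nominal denotes exactly one state. -/
structure HybridModel (Φ Θ : Type) where
  State : Type
  R : State → State → Prop
  V : Φ → Set State
  denot : Θ → State

namespace HybridModel

variable {Φ Θ : Type}

/-- `M.Holds φ g s`: the formula `φ` is true at the state `s` of `M`, where a free state variable
`x` denotes the state `g x`. The binder `↓x` names the current state `x`. -/
def Holds (M : HybridModel Φ Θ) {X : Type} [DecidableEq X] :
    HybridFormula Φ Θ X → (X → M.State) → M.State → Prop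
  | .prop p, _, s => s ∈ M.V p
  | .nom i, _, s => s = M.denot i
  | .var x, g, s => s = g x
  | .neg φ, g, s => ¬ M.Holds φ g s
  | .or φ ψ, g, s => M.Holds φ g s ∨ M.Holds ψ g s
  | .dia φ, g, s => ∃ t, M.R s t ∧ M.Holds φ g t
  | .diaInv φ, g, s => ∃ t, M.R t s ∧ M.Holds φ g t
  | .atNom i φ, g, _ => M.Holds φ g (M.denot i)
  | .atVar x φ, g, _ => M.Holds φ g (g x)
  | .bind x φ, g, s => M.Holds φ (Function.update g x s) s

/-- The extension `⟦φ⟧` of a sentence `φ` in `M`: the set of states at which `φ` is true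
(for a sentence the assignment is irrelevant). -/
def extension (M : HybridModel Φ Θ) {X : Type} [DecidableEq X]
    (φ : HybridFormula Φ Θ X) : Set M.State :=
  {s | ∀ g : X → M.State, M.Holds φ g s}

end HybridModel

/-- The sentence `↓x.⟨R⟩x`. -/
def loopFormula (Φ Θ : Type) : HybridFormula Φ Θ ℕ :=
  .bind 0 (.dia (.var 0))

/-! Finite automata and rational transducers as finite data. Letters and automaton states are named
by natural numbers. Only the finitely many names that occur in the data matter. -/

/-- A nondeterministic finite automaton: initial state, accepting states, and the finite list of
transitions `(q, a, q')`. -/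
structure FinAutomaton where
  start : ℕ
  accept : List ℕ
  trans : List (ℕ × ℕ × ℕ)

/-- The same automaton as an object of Mathlib's type `NFA`. -/
def FinAutomaton.toNFA (A : FinAutomaton) : NFA ℕ ℕ where
  step q a := {q' | (q, a, q') ∈ A.trans}
  start := {A.start}
  accept := {q | q ∈ A.accept}

/-- The language recognized by a finite automaton. -/
def FinAutomaton.language (A : FinAutomaton) : Language ℕ :=
  A.toNFA.accepts

/-- A rational transducer: initial state, accepting states, and the finite list of
transitions `(q, u, v, q')`, labelled by pairs of (possibly empty) words. -/
structure RatTransducer where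
  start : ℕ
  accept : List ℕ
  trans : List (ℕ × List ℕ × List ℕ × ℕ)

/-- `T.Run q u v q'`: some run of `T` from `q` to `q'` reads the pair of words `(u, v)`. -/
inductive RatTransducer.Run (T : RatTransducer) : ℕ → List ℕ → List ℕ → ℕ → Prop
  | nil (q : ℕ) : T.Run q [] [] q
  | cons {q q' q'' : ℕ} {u v u' v' : List ℕ} :
      (q, u, v, q') ∈ T.trans → T.Run q' u' v' q'' → T.Run q (u ++ u') (v ++ v') q''

/-- The binary relation on words recognized by a transducer. -/
def RatTransducer.Rel (T : RatTransducer) (u v : List ℕ) : Prop :=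
  ∃ q ∈ T.accept, T.Run T.start u v q

/-! Rational Kripke models, given by finite presentations. -/

/-- The data presenting a rational Kripke model: a finite alphabet, an automaton for the set of
states, a transducer for the accessibility relation, an automaton for each propositional variable
and a word for each nominal. -/
structure RKMPresentation where
  alphabet : List ℕ
  stateAut : FinAutomaton
  edges : RatTransducer
  props : List FinAutomaton
  noms : List (List ℕ)

namespace RKMPresentation

/-- The data really present a rational Kripke model: all machines work over the alphabet, the
accessibility relation is a relation on the set of states, the propositional variables are valued
in sets of states, and the nominals denote states. -/
structure Valid (P : RKMPresentation) : Prop where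
  stateAut_letters : ∀ t ∈ P.stateAut.trans, t.2.1 ∈ P.alphabet
  edges_letters : ∀ t ∈ P.edges.trans,
    (∀ a ∈ t.2.1, a ∈ P.alphabet) ∧ (∀ a ∈ t.2.2.1, a ∈ P.alphabet)
  props_letters : ∀ A ∈ P.props, ∀ t ∈ A.trans, t.2.1 ∈ P.alphabet
  edges_states : ∀ u v, P.edges.Rel u v →
    u ∈ P.stateAut.language ∧ v ∈ P.stateAut.language
  props_states : ∀ A ∈ P.props, ∀ w ∈ A.language, w ∈ P.stateAut.language
  noms_states : ∀ w ∈ P.noms, w ∈ P.stateAut.language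

/-- The rational Kripke model presented by `P`. -/
def model (P : RKMPresentation) (h : P.Valid) :
    HybridModel (Fin P.props.length) (Fin P.noms.length) where
  State := {w : List ℕ // w ∈ P.stateAut.language}
  R s t := P.edges.Rel s.1 t.1
  V p := {s | s.1 ∈ (P.props.get p).language}
  denot i := ⟨P.noms.get i, h.noms_states _ (P.noms.get_mem i)⟩

end RKMPresentation

/-! The standard coding of presentations: each structure is coded as the tuple of its fields. -/

/-- A finite automaton as the tuple of its fields. -/
def FinAutomaton.equivTuple : FinAutomaton ≃ ℕ × List ℕ × List (ℕ × ℕ × ℕ) where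
  toFun A := (A.start, A.accept, A.trans)
  invFun t := ⟨t.1, t.2.1, t.2.2⟩
  left_inv _ := rfl
  right_inv _ := rfl

instance FinAutomaton.primcodable : Primcodable FinAutomaton :=
  Primcodable.ofEquiv _ FinAutomaton.equivTuple

/-- A transducer as the tuple of its fields. -/
def RatTransducer.equivTuple :
    RatTransducer ≃ ℕ × List ℕ × List (ℕ × List ℕ × List ℕ × ℕ) where
  toFun T := (T.start, T.accept, T.trans)
  invFun t := ⟨t.1, t.2.1, t.2.2⟩
  left_inv _ := rfl
  right_inv _ := rfl

instance RatTransducer.primcodable : Primcodable RatTransducer :=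
  Primcodable.ofEquiv _ RatTransducer.equivTuple

/-- A presentation as the tuple of its fields. -/
def RKMPresentation.equivTuple :
    RKMPresentation ≃
      List ℕ × FinAutomaton × RatTransducer × List FinAutomaton × List (List ℕ) where
  toFun P := (P.alphabet, P.stateAut, P.edges, P.props, P.noms)
  invFun t := ⟨t.1, t.2.1, t.2.2.1, t.2.2.2.1, t.2.2.2.2⟩
  left_inv _ := rfl
  right_inv _ := rfl

instance RKMPresentation.primcodable : Primcodable RKMPresentation :=
  Primcodable.ofEquiv _ RKMPresentation.equivTuple

/-!
A state satisfies `↓x.⟨R⟩x` exactly if it is related to itself, so the claim is that the existence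
of a word `w` with `(w, w)` recognized by a given transducer is undecidable. The halting problem is
reduced to it through queue machines.

While a transducer reads the same word on both tapes with the second tape ahead, the part of the
word that lies between the two reading positions behaves like the content of a queue: what is read
on the second tape is appended at the back, what is read on the first tape is removed from the
front. A deterministic queue machine thus becomes a transducer, started by a transition that writes
the initial queue on the second tape and accepting at the halted states after reading the remaining
queue on the first tape. Its loops are the halting computations
(`QueueMachine.exists_rel_self_iff`). For this it is convenient that every step of the queue
machine appends at least one letter, so that the second tape always stays strictly ahead.

Mathlib compiles partial recursive functions to machines with finitely many stacks
(`Turing.PartrecToTM2`). Such a machine is simulated by a queue machine whose queue is a shuffle of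
the stacks, with letters tagged by the name of their stack, followed by a separator
(`StackQueue.respects_machine`). Each statement takes one pass over the queue.

Now fix one partial recursive function with undecidable domain. Its machine, and hence all
transitions but the first, are fixed, and the first transition depends on the input only through
the initial queue, which holds the binary digits of the input. So the reduction is computable
although the transitions of the fixed machine are merely shown to exist
(`exists_computable_presentation`).
-/

open StateTransition

/-! ### Queue machines -/

/-- A deterministic queue machine with states `Q` and queue letters `L`. At a state `s` with `M s =
some d`, it removes the front letter `a` of the queue, appends the word `(d a).2` at the back and
enters the state `(d a).1`. It has halted at the states `s` with `M s = none`. -/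
abbrev QueueMachine (Q L : Type) : Type :=
  Q → Option (L → Q × List L)

namespace QueueMachine

variable {Q L : Type}

/-- One step of a queue machine. It is also stuck when the queue is empty; for machines that append
a nonempty word at each step this never happens. -/
def step (M : QueueMachine Q L) : Q × List L → Option (Q × List L)
  | (_, []) => none
  | (s, a :: Z) => (M s).map fun d => ((d a).1, Z ++ (d a).2)

theorem step_cons {M : QueueMachine Q L} {s : Q} {d : L → Q × List L} (h : M s = some d)
    (a : L) (Z : List L) : M.step (s, a :: Z) = some ((d a).1, Z ++ (d a).2) := by
  simp [step, h]

/-- Every step appends a nonempty word, so that a nonempty queue never becomes empty. -/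
def Productive (M : QueueMachine Q L) : Prop :=
  ∀ s d, M s = some d → ∀ a, (d a).2 ≠ []

theorem Productive.eval_dom_iff {M : QueueMachine Q L} (hM : M.Productive) {s : Q} {Z : List L}
    (hZ : Z ≠ []) :
    (eval M.step (s, Z)).Dom ↔ ∃ s' Z', Reaches M.step (s, Z) (s', Z') ∧ M s' = none := by
  have key : ∀ c, Reaches M.step (s, Z) c → c.2 ≠ [] := by
    intro c hc
    induction hc with
    | refl => exact hZ
    | @tail b c _ hbc _ =>
      obtain ⟨t, _ | ⟨a, W⟩⟩ := b
      · simp [step] at hbc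
      · rcases hd : M t with _ | d
        · simp [step, hd] at hbc
        · rw [step_cons hd] at hbc
          cases hbc
          simp [hM t d hd a]
  constructor
  · intro h
    obtain ⟨⟨t, W⟩, hc⟩ := Part.dom_iff_mem.1 h
    obtain ⟨hr, hn⟩ := mem_eval.1 hc
    refine ⟨t, W, hr, ?_⟩
    obtain _ | ⟨a, W⟩ := W
    · exact absurd rfl (key _ hr)
    · simpa [step] using hn
  · rintro ⟨s', Z', hr, hn⟩
    have hmem : (s', Z') ∈ eval M.step (s, Z) :=
      mem_eval.2 ⟨hr, by cases Z' <;> simp [step, hn]⟩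
    exact hmem.1

end QueueMachine

/-! ### Transducers related to queue machines -/

namespace QueueMachine

variable {Q L : Type}

/-- The transitions of the transducer that follows a queue machine restricted to the states in `F`:
a step that removes `a` and appends `w` reads `a` on the first tape and `w` on the second; at a
halted state the rest of the first tape is read. States and letters are named through `eQ` and
`eL`; the number `0` is kept free for the start state. -/
def transitions (M : QueueMachine Q L) (F : Set Q) (eQ : Q → ℕ) (eL : L → ℕ) :
    Set (ℕ × List ℕ × List ℕ × ℕ) :=
  {t | ∃ s ∈ F, ∃ a, (∃ d, M s = some d ∧
      t = (eQ s + 1, [eL a], (d a).2.map eL, eQ (d a).1 + 1)) ∨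
    (M s = none ∧ t = (eQ s + 1, [eL a], [], eQ s + 1))}

theorem finite_transitions (M : QueueMachine Q L) {F : Set Q} (hF : F.Finite) [Finite L]
    (eQ : Q → ℕ) (eL : L → ℕ) : (M.transitions F eQ eL).Finite := by
  have h : ∀ p : Q × L, {t : ℕ × List ℕ × List ℕ × ℕ | (∃ d, M p.1 = some d ∧
      t = (eQ p.1 + 1, [eL p.2], (d p.2).2.map eL, eQ (d p.2).1 + 1)) ∨
    (M p.1 = none ∧ t = (eQ p.1 + 1, [eL p.2], [], eQ p.1 + 1))}.Finite := by
    intro p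
    rcases M p.1 with _ | d <;> simp
  refine ((hF.prod (Set.finite_univ (α := L))).biUnion fun p _ => h p).subset ?_
  rintro t ⟨s, hs, a, ht⟩
  exact Set.mem_biUnion (x := (s, a)) ⟨hs, trivial⟩ ht

section

variable {M : QueueMachine Q L} {F : Set Q} {eQ : Q → ℕ} {eL : L → ℕ} {T : RatTransducer}

/-- A halting computation yields a run whose first word is the queue content followed by the second
word: the second tape is ahead of the first one by the content of the queue. -/
theorem exists_run_of_reaches (hFM : ∀ s ∈ F, ∀ d, M s = some d → ∀ a, (d a).1 ∈ F)
    (hT : ∀ t ∈ M.transitions F eQ eL, t ∈ T.trans)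
    {c c' : Q × List L} (h : Reaches M.step c c') (hn : M c'.1 = none) (hc : c.1 ∈ F) :
    c'.1 ∈ F ∧ ∃ v, T.Run (eQ c.1 + 1) (c.2.map eL ++ v) v (eQ c'.1 + 1) := by
  induction h using Relation.ReflTransGen.head_induction_on with
  | refl =>
    refine ⟨hc, [], ?_⟩
    obtain ⟨s, Z⟩ := c'
    induction Z with
    | nil => exact .nil _
    | cons a Z ih =>
      simpa using RatTransducer.Run.cons (hT _ ⟨s, hc, a, .inr ⟨hn, rfl⟩⟩) (ih hn hc)
  | @head b c hbc _ ih =>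
    obtain ⟨s, _ | ⟨a, Z⟩⟩ := b
    · simp [step] at hbc
    · rcases hd : M s with _ | d
      · simp [step, hd] at hbc
      · rw [step_cons hd] at hbc
        cases hbc
        obtain ⟨h1, v, hv⟩ := ih (hFM s hc d hd a)
        refine ⟨h1, (d a).2.map eL ++ v, ?_⟩
        have := RatTransducer.Run.cons (hT _ ⟨s, hc, a, .inl ⟨d, hd, rfl⟩⟩) hv
        simpa using this

/-- Conversely, a run to an accepting state whose second tape is ahead of the first one by a
nonempty queue content follows a halting computation. -/
theorem reaches_of_run (hM : M.Productive)
    (hFM : ∀ s ∈ F, ∀ d, M s = some d → ∀ a, (d a).1 ∈ F)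
    (hQ : Set.InjOn eQ F) (hL : Function.Injective eL)
    (hT : ∀ t ∈ T.trans, t.1 ≠ 0 → t ∈ M.transitions F eQ eL)
    {p r : ℕ} {u v : List ℕ} (h : T.Run p u v r) (hr : ∃ s ∈ F, M s = none ∧ r = eQ s + 1)
    {s : Q} (hs : s ∈ F) (hp : p = eQ s + 1) {Z : List L} (hZ : Z ≠ []) (hu : u = Z.map eL ++ v) :
    ∃ s' Z', Reaches M.step (s, Z) (s', Z') ∧ M s' = none := by
  induction h generalizing s Z with
  | nil q =>
    obtain ⟨s', hs', hn, he⟩ := hr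
    obtain rfl : s = s' := hQ hs hs' (by omega)
    exact ⟨_, _, .refl, hn⟩
  | @cons q q' q'' u v u' v' ht _ ih =>
    obtain ⟨s₁, hs₁, a, ⟨d, hd, h⟩ | ⟨hn, h⟩⟩ := hT _ ht (by simp [hp])
    · -- Matching the first letters shows that the run follows the queue machine.
      simp only [Prod.mk.injEq] at h
      obtain ⟨h1, rfl, rfl, h4⟩ := h
      obtain rfl : s = s₁ := hQ hs hs₁ (by omega)
      obtain _ | ⟨z, W⟩ := Z
      · exact absurd rfl hZ
      · simp only [List.cons_append, List.nil_append, List.map_cons, List.cons.injEq] at hu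
        obtain rfl := hL hu.1
        obtain ⟨s', Z', hr', hn'⟩ := ih hr (hFM s hs d hd a) h4 (Z := W ++ (d a).2)
          (by simp [hM s d hd a]) (by simp [hu.2])
        exact ⟨s', Z', .head (by rw [step_cons hd]; rfl) hr', hn'⟩
    · simp only [Prod.mk.injEq] at h
      obtain rfl : s = s₁ := hQ hs hs₁ (by omega)
      exact ⟨_, _, .refl, hn⟩

/-- If the start state `0` writes the initial queue on the second tape and the other transitions
follow the queue machine, then a word is related to itself exactly if the machine halts. -/
theorem exists_rel_self_iff (hM : M.Productive)
    (hFM : ∀ s ∈ F, ∀ d, M s = some d → ∀ a, (d a).1 ∈ F)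
    (hQ : Set.InjOn eQ F) (hL : Function.Injective eL)
    {s₀ : Q} (hs₀ : s₀ ∈ F) {Z₀ : List L} (hZ₀ : Z₀ ≠ [])
    (hstart : T.start = 0)
    (haccept : ∀ r, r ∈ T.accept ↔ ∃ s ∈ F, M s = none ∧ r = eQ s + 1)
    (htrans : ∀ t, t ∈ T.trans ↔ t = (0, [], Z₀.map eL, eQ s₀ + 1) ∨ t ∈ M.transitions F eQ eL) :
    (∃ w, T.Rel w w) ↔ (eval M.step (s₀, Z₀)).Dom := by
  rw [hM.eval_dom_iff hZ₀]
  constructor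
  · rintro ⟨w, r, hr, h⟩
    rw [haccept] at hr
    rw [hstart] at h
    have key : ∀ p u v, T.Run p u v r → p = 0 → u = v →
        ∃ s' Z', Reaches M.step (s₀, Z₀) (s', Z') ∧ M s' = none := by
      intro p u v h hp huv
      cases h with
      | nil =>
        obtain ⟨s, _, _, h⟩ := hr
        omega
      | cons ht h =>
        obtain h1 | ⟨s, _, a, ⟨d, _, h1⟩ | ⟨_, h1⟩⟩ := (htrans _).1 ht
        · simp only [Prod.mk.injEq] at h1
          obtain ⟨_, rfl, rfl, h4⟩ := h1
          refine reaches_of_run hM hFM hQ hL (fun t ht h0 => ?_) h hr hs₀ h4 hZ₀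
            (by simpa using huv)
          obtain rfl | h := (htrans t).1 ht
          · exact absurd rfl h0
          · exact h
        · simp only [Prod.mk.injEq] at h1
          omega
        · simp only [Prod.mk.injEq] at h1
          omega
    exact key 0 w w h rfl rfl
  · rintro ⟨s', Z', h, hn⟩
    obtain ⟨hs', v, hv⟩ := exists_run_of_reaches (eQ := eQ) (eL := eL) (T := T) hFM
      (fun t ht => (htrans t).2 (.inr ht)) h hn hs₀
    refine ⟨Z₀.map eL ++ v, _, (haccept _).2 ⟨s', hs', hn, rfl⟩, ?_⟩
    rw [hstart]
    have := RatTransducer.Run.cons ((htrans _).2 (.inl rfl)) hv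
    simpa using this

end

end QueueMachine

/-! ### Stack machines as queue machines -/

namespace StackQueue

open Turing Turing.TM2

variable {K Γ Λ σ : Type}

/-- The queue letters: `none` separates two passes over the queue, `some none` is a blank left
behind by a popped letter, and `some (some (k, a))` is the letter `a` on the stack `k`. -/
abbrev Letter (K Γ : Type) : Type := Option (Option (K × Γ))

/-- The states of the queue machine: a flag telling that the rest of the present pass is to be
copied first, the statement to be executed after that (`none` when the stack machine has halted),
and the internal memory. -/
abbrev State (K Γ Λ σ : Type) : Type := Bool × Option (Stmt (fun _ : K => Γ) Λ σ) × σ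

/-- The states that occur when the stack machine stays within the labels in `S`. -/
def states (M : Λ → Stmt (fun _ : K => Γ) Λ σ) (S : Finset Λ) : Set (State K Γ Λ σ) :=
  {s | s.2.1 ∈ stmts M S}

theorem finite_states [Finite σ] (M : Λ → Stmt (fun _ : K => Γ) Λ σ) (S : Finset Λ) :
    (states M S).Finite := by
  refine ((Set.finite_univ (α := Bool)).prod
    ((stmts M S).finite_toSet.prod (Set.finite_univ (α := σ)))).subset ?_
  rintro ⟨b, o, v⟩ h
  exact ⟨trivial, h, trivial⟩

theorem some_mem_stmts {M : Λ → Stmt (fun _ : K => Γ) Λ σ} {S : Finset Λ} {l : Λ} (h : l ∈ S) :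
    some (M l) ∈ stmts M S := by
  simp only [stmts, Finset.some_mem_insertNone, Finset.mem_biUnion]
  exact ⟨l, h, stmts₁_self⟩

variable [DecidableEq K]

/-- The content at the stack `k` of a queue letter. -/
def proj (k : K) : Letter K Γ → Option Γ
  | some (some (j, a)) => if j = k then some a else none
  | _ => none

/-- A separator-free queue `w` represents the stacks `S`: the letters tagged `k` are, in order from
the top, the content of the stack `k`. -/
def Represents (w : List (Letter K Γ)) (S : K → List Γ) : Prop :=
  none ∉ w ∧ ∀ k, w.filterMap (proj k) = S k

/-- Copy letters from the front to the back of the queue up to and including the separator, then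
execute `o`. The flag `x.isSome` tells whether the copied letter `x` is not the separator. -/
def copy (o : Option (Stmt (fun _ : K => Γ) Λ σ)) (v : σ) (x : Letter K Γ) :
    State K Γ Λ σ × List (Letter K Γ) :=
  ((x.isSome, o, v), [x])

/-- The queue machine that simulates a stack machine. A statement takes one pass over the queue. A
pushed letter is written before the first letter of the pass is copied; to read the stack `k`, the
pass looks for the first letter tagged `k`. A popped letter is replaced by a blank instead of being
dropped, so that every step appends a letter. -/
def machine (M : Λ → Stmt (fun _ : K => Γ) Λ σ) : QueueMachine (State K Γ Λ σ) (Letter K Γ)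
  | (true, o, v) => some (copy o v)
  | (false, none, _) => none
  | (false, some (.push k f q), v) =>
    some fun x => ((copy (some q) v x).1, [some (some (k, f v)), x])
  | (false, some (.peek k f q), v) => some fun
    | none => ((false, some q, f v none), [none])
    | some x => match proj k (some x) with
      | some a => ((true, some q, f v (some a)), [some x])
      | none => ((false, some (.peek k f q), v), [some x])
  | (false, some (.pop k f q), v) => some fun
    | none => ((false, some q, f v none), [none])
    | some x => match proj k (some x) with
      | some a => ((true, some q, f v (some a)), [some none])
      | none => ((false, some (.pop k f q), v), [some x])
  | (false, some (.load f q), v) => some (copy (some q) (f v))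
  | (false, some (.branch f q₁ q₂), v) => some (copy (some (cond (f v) q₁ q₂)) v)
  | (false, some (.goto l), v) => some (copy (some (M (l v))) v)
  | (false, some .halt, v) => some (copy none v)

theorem reaches₁_head {α : Type} {f : α → Option α} {a b c : α} (h : f a = some b)
    (h' : Reaches₁ f b c) : Reaches₁ f a c :=
  .head h h'

theorem productive_machine (M : Λ → Stmt (fun _ : K => Γ) Λ σ) : (machine M).Productive := by
  intro s d h a
  unfold machine at h
  split at h <;> cases h <;> try simp [copy]
  all_goals
    rcases a with _ | x
    · simp
    · dsimp only
      split <;> simp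

theorem machine_mem_states [Inhabited Λ] {M : Λ → Stmt (fun _ : K => Γ) Λ σ} {S : Finset Λ}
    (hS : Supports M S) (s : State K Γ Λ σ) (hs : s ∈ states M S) (d) (h : machine M s = some d)
    (a : Letter K Γ) : (d a).1 ∈ states M S := by
  simp only [states, Set.mem_ofPred_eq] at hs ⊢
  unfold machine at h
  split at h <;> cases h <;> simp only [copy] at hs ⊢
  · exact hs
  · exact stmts_trans (by simp [stmts₁, stmts₁_self]) hs
  · rename_i k f q v
    have hq : some q ∈ stmts M S := stmts_trans (by simp [stmts₁, stmts₁_self]) hs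
    rcases a with _ | x
    · exact hq
    · dsimp only
      split
      · exact hq
      · exact hs
  · rename_i k f q v
    have hq : some q ∈ stmts M S := stmts_trans (by simp [stmts₁, stmts₁_self]) hs
    rcases a with _ | x
    · exact hq
    · dsimp only
      split
      · exact hq
      · exact hs
  · exact stmts_trans (by simp [stmts₁, stmts₁_self]) hs
  · refine stmts_trans ?_ hs
    rename_i f q₁ q₂ v
    cases f v <;> simp [stmts₁, stmts₁_self]
  · exact some_mem_stmts (stmts_supportsStmt hS hs _)
  · simp [stmts]

section

variable {M : Λ → Stmt (fun _ : K => Γ) Λ σ}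

/-- A state that only copies passes control to `o` after one pass. -/
theorem reaches_copy {s : State K Γ Λ σ} {o : Option (Stmt (fun _ : K => Γ) Λ σ)} {v : σ}
    (hs : machine M s = some (copy o v)) {w : List (Letter K Γ)} (hw : none ∉ w)
    (w' : List (Letter K Γ)) :
    Reaches₁ (machine M).step (s, w ++ none :: w') ((false, o, v), w' ++ w ++ [none]) := by
  induction w generalizing s w' with
  | nil =>
    refine .single ?_
    simp only [List.nil_append, List.append_nil]
    rw [QueueMachine.step_cons hs]
    rfl
  | cons x w ih =>
    simp only [List.mem_cons, not_or] at hw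
    have h := ih (s := (true, o, v)) rfl hw.2 (w' ++ [x])
    refine reaches₁_head ?_ (by simpa using h)
    rw [List.cons_append, QueueMachine.step_cons hs]
    obtain ⟨y, rfl⟩ := Option.ne_none_iff_exists'.1 (Ne.symm hw.1)
    simp [copy]

theorem reaches_push {k : K} {f : σ → Γ} {q : Stmt (fun _ : K => Γ) Λ σ} {v : σ}
    {w : List (Letter K Γ)} (hw : none ∉ w) :
    Reaches₁ (machine M).step ((false, some (.push k f q), v), w ++ [none])
      ((false, some q, v), some (some (k, f v)) :: w ++ [none]) := by
  cases w with
  | nil => exact .single rfl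
  | cons x w =>
    simp only [List.mem_cons, not_or] at hw
    have h := reaches_copy (M := M) (s := (true, some q, v)) rfl hw.2 [some (some (k, f v)), x]
    refine reaches₁_head ?_ (by simpa using h)
    rw [List.cons_append, QueueMachine.step_cons rfl]
    obtain ⟨y, rfl⟩ := Option.ne_none_iff_exists'.1 (Ne.symm hw.1)
    simp [copy]

theorem reaches_peek {k : K} {f : σ → Option Γ → σ} {q : Stmt (fun _ : K => Γ) Λ σ} {v : σ}
    {w : List (Letter K Γ)} (hw : none ∉ w) (w' : List (Letter K Γ)) :
    Reaches₁ (machine M).step ((false, some (.peek k f q), v), w ++ none :: w')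
      ((false, some q, f v (w.filterMap (proj k)).head?), w' ++ w ++ [none]) := by
  induction w generalizing w' with
  | nil => exact .single (by simp [QueueMachine.step, machine])
  | cons x w ih =>
    simp only [List.mem_cons, not_or] at hw
    obtain ⟨y, rfl⟩ := Option.ne_none_iff_exists'.1 (Ne.symm hw.1)
    rcases hy : proj k (some y) with _ | a
    · refine reaches₁_head ?_ (by simpa [hy] using ih hw.2 (w' ++ [some y]))
      rw [List.cons_append, QueueMachine.step_cons rfl]
      simp [hy]
    · have h := reaches_copy (M := M) (s := (true, some q, f v (some a))) rfl hw.2 (w' ++ [some y])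
      refine reaches₁_head ?_ (by simpa [hy] using h)
      rw [List.cons_append, QueueMachine.step_cons rfl]
      simp [hy]

theorem proj_eq_some {k : K} {x : Letter K Γ} {a : Γ} (h : proj k x = some a) :
    x = some (some (k, a)) := by
  rcases x with _ | _ | ⟨j, b⟩ <;> simp_all [proj]

theorem reaches_pop {k : K} {f : σ → Option Γ → σ} {q : Stmt (fun _ : K => Γ) Λ σ} {v : σ}
    {w : List (Letter K Γ)} (hw : none ∉ w) (w' : List (Letter K Γ)) :
    ∃ u, none ∉ u ∧ (∀ j, u.filterMap (proj j) =
        if j = k then (w.filterMap (proj k)).tail else w.filterMap (proj j)) ∧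
      Reaches₁ (machine M).step ((false, some (.pop k f q), v), w ++ none :: w')
        ((false, some q, f v (w.filterMap (proj k)).head?), w' ++ u ++ [none]) := by
  induction w generalizing w' with
  | nil => exact ⟨[], by simp, by simp, .single (by simp [QueueMachine.step, machine])⟩
  | cons x w ih =>
    simp only [List.mem_cons, not_or] at hw
    obtain ⟨y, rfl⟩ := Option.ne_none_iff_exists'.1 (Ne.symm hw.1)
    rcases hy : proj k (some y) with _ | a
    · obtain ⟨u, hu, hp, h⟩ := ih hw.2 (w' ++ [some y])
      refine ⟨some y :: u, by simp [hu], fun j => ?_, reaches₁_head ?_ (by simpa [hy] using h)⟩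
      · rw [List.filterMap_cons, hp j, List.filterMap_cons, List.filterMap_cons]
        by_cases hj : j = k
        · subst hj
          simp [hy]
        · simp [hj]
      · rw [List.cons_append, QueueMachine.step_cons rfl]
        simp [hy]
    · have h := reaches_copy (M := M) (s := (true, some q, f v (some a))) rfl hw.2
        (w' ++ [some none])
      refine ⟨some none :: w, by simp [hw.2], fun j => ?_, reaches₁_head ?_ (by simpa [hy] using h)⟩
      · by_cases hj : j = k
        · subst hj
          rw [List.filterMap_cons, List.filterMap_cons, hy]
          simp [proj]
        · rw [proj_eq_some hy, List.filterMap_cons, List.filterMap_cons]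
          simp [proj, hj, Ne.symm hj]
      · rw [List.cons_append, QueueMachine.step_cons rfl]
        simp [hy]

/-- Running all of a statement on the queue has the effect that it has on the stacks. -/
theorem reaches_stepAux (q : Stmt (fun _ : K => Γ) Λ σ) (v : σ) (S : K → List Γ)
    {w : List (Letter K Γ)} (hw : Represents w S) :
    ∃ w', Represents w' (stepAux q v S).stk ∧
      Reaches₁ (machine M).step ((false, some q, v), w ++ [none])
        ((false, (stepAux q v S).l.map M, (stepAux q v S).var), w' ++ [none]) := by
  induction q generalizing v S w with
  | push k f q ih =>
    obtain ⟨w', h1, h2⟩ := ih v (Function.update S k (f v :: S k))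
      (w := some (some (k, f v)) :: w) ⟨by simp [hw.1], fun j => by
        by_cases hj : j = k
        · subst hj
          simp [proj, hw.2]
        · simp [proj, hw.2, hj, Ne.symm hj]⟩
    exact ⟨w', h1, (reaches_push hw.1).trans h2⟩
  | peek k f q ih =>
    obtain ⟨w', h1, h2⟩ := ih (f v (S k).head?) S hw
    have h := reaches_peek (M := M) (k := k) (f := f) (q := q) (v := v) hw.1 []
    rw [hw.2 k] at h
    exact ⟨w', h1, h.trans h2⟩
  | pop k f q ih =>
    obtain ⟨u, hu, hp, h⟩ := reaches_pop (M := M) (k := k) (f := f) (q := q) (v := v) hw.1 []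
    obtain ⟨w', h1, h2⟩ := ih (f v (S k).head?) (Function.update S k (S k).tail) (w := u)
      ⟨hu, fun j => by
        rw [hp, hw.2, hw.2]
        by_cases hj : j = k
        · subst hj
          simp
        · simp [hj]⟩
    rw [hw.2 k] at h
    exact ⟨w', h1, h.trans h2⟩
  | load f q ih =>
    obtain ⟨w', h1, h2⟩ := ih (f v) S hw
    exact ⟨w', h1, (reaches_copy (M := M) (s := (false, some (.load f q), v)) rfl hw.1 []).trans h2⟩
  | branch f q₁ q₂ ih₁ ih₂ =>
    have h := reaches_copy (M := M) (s := (false, some (.branch f q₁ q₂), v)) rfl hw.1 []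
    rw [stepAux]
    cases hf : f v
    · rw [hf] at h
      obtain ⟨w', h1, h2⟩ := ih₂ v S hw
      exact ⟨w', h1, h.trans h2⟩
    · rw [hf] at h
      obtain ⟨w', h1, h2⟩ := ih₁ v S hw
      exact ⟨w', h1, h.trans h2⟩
  | goto l =>
    exact ⟨w, hw, reaches_copy (M := M) (s := (false, some (.goto l), v)) rfl hw.1 []⟩
  | halt =>
    exact ⟨w, hw, reaches_copy (M := M) (s := (false, some .halt, v)) rfl hw.1 []⟩

/-- A configuration of the queue machine, at the beginning of a pass, that simulates a
configuration of the stack machine. -/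
def Simulates (M : Λ → Stmt (fun _ : K => Γ) Λ σ) (c : Cfg (fun _ : K => Γ) Λ σ)
    (c' : State K Γ Λ σ × List (Letter K Γ)) : Prop :=
  ∃ w, Represents w c.stk ∧ c' = ((false, c.l.map M, c.var), w ++ [none])

theorem respects_machine (M : Λ → Stmt (fun _ : K => Γ) Λ σ) :
    Respects (TM2.step M) (machine M).step (Simulates M) := by
  rintro ⟨_ | l, v, S⟩ _ ⟨w, hw, rfl⟩
  · cases w <;> rfl
  · obtain ⟨w', h1, h2⟩ := reaches_stepAux (M := M) (M l) v S hw
    exact ⟨_, ⟨w', h1, rfl⟩, h2⟩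

end

end StackQueue

/-! ### The halting problem for stack machines -/

namespace StackQueue

open Turing Turing.TM2 Turing.PartrecToTM2

theorem trNat_bit (b : Bool) {n : ℕ} (hn : Nat.bit b n ≠ 0) :
    trNat (Nat.bit b n) = cond b Γ'.bit1 Γ'.bit0 :: trNat n := by
  simp only [trNat]
  rw [← Num.ofNat'_eq, ← Num.ofNat'_eq, Num.ofNat'_bit]
  cases b
  · rcases h : Num.ofNat' n with _ | p
    · rw [Num.ofNat'_eq] at h
      have : n = 0 := by
        rw [← Num.to_of_nat n, h]
        rfl
      simp [this] at hn
    · rfl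
  · rcases Num.ofNat' n with _ | p <;> rfl

/-- The binary digits that encode a number on a stack, least significant first, are computable. -/
theorem primrec_map_trNat (g : Γ' → ℕ) : Primrec fun n => (trNat n).map g := by
  have h : Primrec₂ fun (_ : Unit) n => (trNat n).map g := by
    -- Recursion on the halves: `IH` lists the values below `n`, and its length is `n`.
    refine Primrec.nat_strong_rec _
      (g := fun _ IH => if IH.length = 0 then some [] else
        (IH[IH.length.div2]?).map fun l =>
          (bif IH.length.bodd then g .bit1 else g .bit0) :: l) ?_ ?_
    · have hlen : Primrec fun p : Unit × List (List ℕ) => p.2.length :=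
        Primrec.list_length.comp Primrec.snd
      refine Primrec.ite (Primrec.eq.comp hlen (Primrec.const 0)) (Primrec.const _) ?_
      refine Primrec.option_map
        (Primrec.list_getElem?.comp Primrec.snd (Primrec.nat_div2.comp hlen)) ?_
      exact Primrec.list_cons.comp
        (Primrec.cond (Primrec.nat_bodd.comp (hlen.comp Primrec.fst)) (Primrec.const _)
          (Primrec.const _)) Primrec.snd
    · rintro ⟨⟩ n
      by_cases hn : n = 0
      · simp [hn]
      · have hlt : n.div2 < n := by
          rw [Nat.div2_val]
          omega
        have h := trNat_bit n.bodd (n := n.div2) (by rwa [Nat.bit_bodd_div2])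
        rw [Nat.bit_bodd_div2] at h
        simp only [List.length_map, List.length_range, hn, if_false, List.getElem?_map,
          List.getElem?_range hlt, Option.map_some, h, List.map_cons]
        cases n.bodd <;> rfl
  exact h.comp (Primrec.const ()) Primrec.id

/-- The initial queue for the input `n`. -/
def initQueue (n : ℕ) : List (Letter K' Γ') :=
  (trList [n]).map (fun a => some (some (.main, a))) ++ [none]

theorem simulates_init (c : ToPartrec.Code) (n : ℕ) :
    Simulates tr (init c [n])
      ((false, some (tr (trNormal c .halt)), none), initQueue n) := by
  refine ⟨_, ⟨?_, fun k => ?_⟩, rfl⟩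
  · simp
  · have : ∀ l : List Γ', (l.map fun a => some (some (K'.main, a))).filterMap (proj k) =
        K'.elim l [] [] [] k := by
      intro l
      rw [List.filterMap_map]
      cases k
      · exact List.filterMap_some
      all_goals exact List.filterMap_eq_nil_iff.2 fun _ _ => rfl
    exact this _

theorem primrec_map_initQueue (e : Letter K' Γ' → ℕ) :
    Primrec fun n => (initQueue n).map e := by
  have h := Primrec.list_append.comp
    (primrec_map_trNat fun a => e (some (some (.main, a))))
    (Primrec.const [e (some (some (.main, .cons))), e none])
  refine h.of_eq fun n => ?_
  simp [initQueue, trList, Function.comp_def]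

theorem eval_dom_iff (c : ToPartrec.Code) (n : ℕ) :
    (eval (machine tr).step ((false, some (tr (trNormal c .halt)), none), initQueue n)).Dom ↔
      (c.eval [n]).Dom := by
  rw [tr_eval_dom (respects_machine tr) (simulates_init c n), PartrecToTM2.tr_eval]
  rfl

end StackQueue

/-- Some partial recursive function of one number has an undecidable domain. -/
theorem exists_code_not_computablePred :
    ∃ c : Turing.ToPartrec.Code, ¬ ComputablePred fun n => (c.eval [n]).Dom := by
  let f : ℕ →. ℕ := fun n => (Nat.Partrec.Code.ofNatCode n).eval 0
  have hf : Partrec f := by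
    have h := Nat.Partrec.Code.eval_part.comp (Computable.ofNat Nat.Partrec.Code)
      (Computable.const 0)
    exact h
  obtain ⟨c, hc⟩ := Turing.ToPartrec.Code.exists_code (Nat.Partrec'.part_iff₁.2 hf)
  -- The halting problem for codes on the input `0` reduces to the domain of `f` by `encode`.
  refine ⟨c, fun h => ComputablePred.halting_problem 0 ?_⟩
  refine ComputablePred.computable_of_manyOneReducible
    ⟨Encodable.encode, Computable.encode, fun d => ?_⟩ h
  have h2 : c.eval [Encodable.encode d] = pure <$> f (Encodable.encode d) :=
    hc ⟨[Encodable.encode d], rfl⟩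
  have h3 : f (Encodable.encode d) = d.eval 0 :=
    congrArg (fun d : Nat.Partrec.Code => d.eval 0) (Denumerable.ofNat_encode d)
  rw [h2, h3]
  rfl

/-! ### The presentations -/

/-- The automaton that accepts all words over the alphabet `A`. -/
def FinAutomaton.univ (A : List ℕ) : FinAutomaton where
  start := 0
  accept := [0]
  trans := A.map fun a => (0, a, 0)

theorem FinAutomaton.mem_language_univ {A w : List ℕ} (h : ∀ a ∈ w, a ∈ A) :
    w ∈ (FinAutomaton.univ A).language := by
  have key : ∀ s : Set ℕ, 0 ∈ s → w ∈ (FinAutomaton.univ A).toNFA.acceptsFrom s := by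
    induction w with
    | nil =>
      intro s hs
      rw [NFA.nil_mem_acceptsFrom]
      exact ⟨0, hs, by simp [toNFA, univ]⟩
    | cons a w ih =>
      intro s hs
      rw [NFA.cons_mem_acceptsFrom]
      refine ih (fun b hb => h b (by simp [hb])) _ ?_
      rw [NFA.mem_stepSet]
      refine ⟨0, hs, ?_⟩
      have := h a (by simp)
      simpa [toNFA, univ] using this
  exact key _ rfl

theorem RatTransducer.Run.letters {T : RatTransducer} {A : List ℕ}
    (hT : ∀ t ∈ T.trans, (∀ a ∈ t.2.1, a ∈ A) ∧ (∀ a ∈ t.2.2.1, a ∈ A))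
    {p r : ℕ} {u v : List ℕ} (h : T.Run p u v r) : (∀ a ∈ u, a ∈ A) ∧ (∀ a ∈ v, a ∈ A) := by
  induction h with
  | nil => simp
  | cons ht _ ih =>
    have := hT _ ht
    simp only [List.mem_append]
    exact ⟨fun a ha => ha.elim (this.1 a) (ih.1 a), fun a ha => ha.elim (this.2 a) (ih.2 a)⟩

/-- The presentation whose states are all words over `A` and whose accessibility relation is given
by a transducer with start state `0`. There are no propositional variables and no nominals. -/
def presentation (A accept : List ℕ) (trans : List (ℕ × List ℕ × List ℕ × ℕ)) :
    RKMPresentation where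
  alphabet := A
  stateAut := .univ A
  edges := ⟨0, accept, trans⟩
  props := []
  noms := []

theorem valid_presentation {A accept : List ℕ} {trans : List (ℕ × List ℕ × List ℕ × ℕ)}
    (hT : ∀ t ∈ trans, (∀ a ∈ t.2.1, a ∈ A) ∧ (∀ a ∈ t.2.2.1, a ∈ A)) :
    (presentation A accept trans).Valid where
  stateAut_letters := by simp [presentation, FinAutomaton.univ]
  edges_letters := hT
  props_letters := by simp [presentation]
  edges_states := by
    rintro u v ⟨r, _, h⟩
    have := h.letters (A := A) hT
    exact ⟨FinAutomaton.mem_language_univ this.1, FinAutomaton.mem_language_univ this.2⟩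
  props_states := by simp [presentation]
  noms_states := by simp [presentation]

theorem RKMPresentation.extension_loopFormula_nonempty_iff (P : RKMPresentation) (hP : P.Valid) :
    ((P.model hP).extension (loopFormula _ _)).Nonempty ↔ ∃ w, P.edges.Rel w w := by
  constructor
  · rintro ⟨s, hs⟩
    obtain ⟨t, ht, hts⟩ := hs fun _ => s
    refine ⟨s.1, ?_⟩
    have hts : t = s := by simpa [HybridModel.Holds] using hts
    rw [hts] at ht
    exact ht
  · rintro ⟨w, hw⟩
    obtain ⟨s, hs⟩ : ∃ s : (P.model hP).State, (P.model hP).R s s :=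
      ⟨⟨w, (hP.edges_states w w hw).1⟩, hw⟩
    exact ⟨s, fun g => ⟨s, hs, by rw [HybridModel.Holds, Function.update_self]⟩⟩

theorem computable_presentation (A accept : List ℕ) {f : ℕ → List (ℕ × List ℕ × List ℕ × ℕ)}
    (hf : Computable f) : Computable fun n => presentation A accept (f n) := by
  have hT : Computable fun n => (⟨0, accept, f n⟩ : RatTransducer) :=
    (Primrec.of_equiv_symm (e := RatTransducer.equivTuple)).to_comp.comp
      ((Computable.const 0).pair ((Computable.const accept).pair hf))
  exact (Primrec.of_equiv_symm (e := RKMPresentation.equivTuple)).to_comp.comp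
    ((Computable.const A).pair ((Computable.const (FinAutomaton.univ A)).pair
      (hT.pair ((Computable.const []).pair (Computable.const [])))))

open Turing Turing.PartrecToTM2 StackQueue in
/-- The halting problem of a fixed partial recursive function reduces to the existence of a loop in
a rational Kripke model. Only the transition that writes the initial queue depends on the input. -/
theorem exists_computable_presentation (c : Turing.ToPartrec.Code) :
    ∃ P : ℕ → RKMPresentation, Computable P ∧ (∀ n, (P n).Valid) ∧
      ∀ n, (∃ w, (P n).edges.Rel w w) ↔ (c.eval [n]).Dom := by
  let S := codeSupp c .halt
  -- `TM2.Supports` refers to the start label as the default one.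
  let _ : Inhabited Λ' := ⟨trNormal c .halt⟩
  have hS : @TM2.Supports K' (fun _ => Γ') Λ' (Option Γ') ⟨trNormal c .halt⟩ tr S :=
    tr_supports c .halt
  have : Finite K' := @Finite.of_fintype K' ⟨{.main, .rev, .aux, .stack}, by rintro ⟨⟩ <;> simp⟩
  let F := states tr S
  have hF : F.Finite := finite_states tr S
  -- A numbering of the states is needed on the finite set `F` only; the type of all statements,
  -- which contain functions on labels, need not be countable.
  obtain ⟨eQ, hQ⟩ := Set.countable_iff_exists_injOn.1 hF.countable
  obtain ⟨eL, hL⟩ := Countable.exists_injective_nat (Letter K' Γ')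
  let M := machine tr
  let s₀ : State K' Γ' Λ' (Option Γ') := (false, some (tr (trNormal c .halt)), none)
  have hs₀ : s₀ ∈ F := some_mem_stmts hS.1
  have hTf := M.finite_transitions hF eQ eL
  have hAf : {r | ∃ s ∈ F, M s = none ∧ r = eQ s + 1}.Finite :=
    (hF.image fun s => eQ s + 1).subset fun r ⟨s, hs, _, h⟩ => ⟨s, hs, h.symm⟩
  have hLf := Set.finite_range eL
  let A := hLf.toFinset.toList
  have hA : ∀ x, eL x ∈ A := fun x => by simp [A]
  refine ⟨fun n => presentation A hAf.toFinset.toList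
    ((0, [], (initQueue n).map eL, eQ s₀ + 1) :: hTf.toFinset.toList), ?_, fun n => ?_, fun n => ?_⟩
  · refine computable_presentation _ _ ?_
    exact Computable.list_cons.comp
      ((Computable.const 0).pair ((Computable.const []).pair
        ((primrec_map_initQueue eL).to_comp.pair (Computable.const _)))) (Computable.const _)
  · refine valid_presentation fun t ht => ?_
    simp only [List.mem_cons, Finset.mem_toList, Set.Finite.mem_toFinset] at ht
    obtain rfl | ⟨s, _, a, ⟨d, _, rfl⟩ | ⟨_, rfl⟩⟩ := ht <;> simp [hA]
  · rw [← eval_dom_iff]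
    exact QueueMachine.exists_rel_self_iff (M := M) (eQ := eQ) (eL := eL)
      (productive_machine tr) (machine_mem_states hS) hQ hL hs₀ (by simp [initQueue]) rfl
      (fun r => Finset.mem_toList.trans hAf.mem_toFinset)
      (fun t => List.mem_cons.trans
        (or_congr_right (Finset.mem_toList.trans hTf.mem_toFinset)))

/-- No algorithm, given a presentation of a rational Kripke model as input (on all other inputs it
may do anything, including not halting), decides whether the sentence `↓x.⟨R⟩x` holds at some state
of the model. -/
theorem mainTheorem6 :
    ¬ ∃ f : RKMPresentation →. Bool, Partrec f ∧
      ∀ (P : RKMPresentation) (hP : P.Valid), ∃ b ∈ f P,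
        (b = true ↔ ((P.model hP).extension (loopFormula _ _)).Nonempty) := by
  classical
  rintro ⟨f, hf, h⟩
  obtain ⟨c, hc⟩ := exists_code_not_computablePred
  obtain ⟨P, hP, hV, hD⟩ := exists_computable_presentation c
  refine hc ⟨inferInstance, (hf.comp hP).of_eq fun n => ?_⟩
  obtain ⟨b, hb, hb'⟩ := h (P n) (hV n)
  rw [RKMPresentation.extension_loopFormula_nonempty_iff, hD] at hb'
  rw [Part.eq_some_iff.2 hb]
  congr 1
  exact Bool.eq_iff_iff.2 (by simpa using hb')
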